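/- For positive integers $m$ and $n$, let the partial permutohedron $\mathcal{P}(m,n)\subseteq\mathbb{R}^m$ be the convex hull of all vectors in $\{0,1,\ldots,n\}^m$ whose nonzero entries are distinct. For a full-dimensional polytope $P\subseteq\mathbb{R}^m$, let the normalized volume of $P$ be $m!$ times its Lebesgue volume. Then, for every positive integer $m$, the normalized volume of $\mathcal{P}(m,4)$ is $$10^m-m\,6^m-\frac{m(m-1)(m-3)}{6}\,3^m-(3m^2-6m+1)\binom{m}{3}.$$ -/

import Mathlib

/-- The vectors in `{0, 1, …, n} ^ m`, viewed in `ℝ ^ m`, whose nonzero entries are distinct. -/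
def partialPermutationVectors (m n : ℕ) : Set (Fin m → ℝ) :=
  {x | ∃ w : Fin m → ℕ, (∀ i, w i ≤ n) ∧ (∀ i j, w i ≠ 0 → w i = w j → i = j) ∧
    ∀ i, x i = (w i : ℝ)}

/-- The partial permutohedron `𝒫(m, n)`: the convex hull in `ℝ ^ m` of all vectors in
`{0, 1, …, n} ^ m` whose nonzero entries are distinct. -/
def partialPermutohedron (m n : ℕ) : Set (Fin m → ℝ) :=
  convexHull ℝ (partialPermutationVectors m n)

/-- The normalized volume of a (full-dimensional) polytope in `ℝ ^ m`: `m !` times its Lebesgue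
volume, so that the standard `m`-simplex has normalized volume `1` and the unit cube has
normalized volume `m !`. -/
noncomputable def normalizedVolume {m : ℕ} (P : Set (Fin m → ℝ)) : ℝ :=
  (m.factorial : ℝ) * MeasureTheory.volume.real P

open MeasureTheory

/-! The bounds 4, 7, 9, 10 are the sums of the largest one, two, three and four of the values 4, 3,
2, 1. Over the polytope they define, a linear functional is maximized greedily: give 4, 3, 2, 1 to
the coordinates of largest positive weight (`exists_vertex_ge`, by Abel summation). With Hahn–Banach
separation this gives `partialPermutohedron_four_eq`.

Up to a null set, the polytope is the simplex of coordinate sum at most 10, of normalized volume `10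
^ m`, minus three disjoint regions, according to which inequality fails first
(`cornerSimplex_ten_eq`). At most two coordinates exceed 4, so inclusion-exclusion gives `m * 6 ^ m
- m.choose 2 * 2 ^ m` for the first region. The pair cuts are pairwise disjoint, as are the triple
cuts; each has a volume found by Fubini, the remaining coordinates filling a smaller simplex. The `2
^ m` terms cancel in the total. -/

/-! ### Inequality description of the partial permutohedron -/

/-- The polytope cut out by the facet inequalities of `𝒫(m, 4)`. -/
def facetPolytope (m : ℕ) : Set (Fin m → ℝ) :=
  {x | (∀ i, 0 ≤ x i) ∧ (∀ i, x i ≤ 4) ∧ (∀ i j, i ≠ j → x i + x j ≤ 7) ∧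
    (∀ i j k, i ≠ j → i ≠ k → j ≠ k → x i + x j + x k ≤ 9) ∧ ∑ i, x i ≤ 10}

theorem convex_facetPolytope (m : ℕ) : Convex ℝ (facetPolytope m) := by
  rintro x ⟨hx0, hx1, hx2, hx3, hx4⟩ y ⟨hy0, hy1, hy2, hy3, hy4⟩ a b ha hb hab
  have key : ∀ u v c : ℝ, u ≤ c → v ≤ c → a * u + b * v ≤ c := fun u v c hu hv => by
    calc a * u + b * v ≤ a * c + b * c := by gcongr
      _ = c := by rw [← add_mul, hab, one_mul]
  simp only [facetPolytope, Set.mem_ofPred_eq, Pi.add_apply, Pi.smul_apply, smul_eq_mul]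
  refine ⟨fun i => ?_, fun i => key _ _ _ (hx1 i) (hy1 i), fun i j h => ?_,
    fun i j k h h' h'' => ?_, ?_⟩
  · have := hx0 i
    have := hy0 i
    positivity
  · linarith [key _ _ _ (hx2 i j h) (hy2 i j h)]
  · linarith [key _ _ _ (hx3 i j k h h' h'') (hy3 i j k h h' h'')]
  · rw [Finset.sum_add_distrib, ← Finset.mul_sum, ← Finset.mul_sum]
    exact key _ _ _ hx4 hy4

theorem sum_le_ten_of_injOn {m : ℕ} {w : Fin m → ℕ} (hw : ∀ i, w i ≤ 4)
    (hinj : ∀ i j, w i ≠ 0 → w i = w j → i = j) : ∑ i, w i ≤ 10 := by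
  classical
  have h1 : ∑ i, w i = ∑ i with w i ≠ 0, w i := (Finset.sum_filter_ne_zero _).symm
  have h2 : ∑ i with w i ≠ 0, w i = ∑ v ∈ (Finset.univ.filter (w · ≠ 0)).image w, v := by
    rw [Finset.sum_image]
    intro i hi j _ hij
    exact hinj i j (by simpa using hi) hij
  have h3 : (Finset.univ.filter (w · ≠ 0)).image w ⊆ Finset.range 5 := by
    intro v hv
    obtain ⟨i, -, rfl⟩ := Finset.mem_image.1 hv
    exact Finset.mem_range.2 (Nat.lt_succ_of_le (hw i))
  rw [h1, h2]
  exact (Finset.sum_le_sum_of_subset h3).trans (by decide)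

theorem partialPermutationVectors_subset (m : ℕ) :
    partialPermutationVectors m 4 ⊆ facetPolytope m := by
  rintro x ⟨w, hw, hinj, hx⟩
  obtain rfl : x = fun i => (w i : ℝ) := funext hx
  refine ⟨fun i => Nat.cast_nonneg _, fun i => ?_, fun i j hij => ?_,
    fun i j k hij hik hjk => ?_, ?_⟩
  · beta_reduce; exact_mod_cast hw i
  · have h := hinj i j
    have h1 := hw i
    have h2 := hw j
    have : w i + w j ≤ 7 := by
      by_contra hlt
      exact hij (h (by omega) (by omega))
    beta_reduce; exact_mod_cast this
  · have hi := hw i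
    have hj := hw j
    have hk := hw k
    have h1 : w i ≠ 0 → w i ≠ w j := fun h h' => hij (hinj i j h h')
    have h2 : w i ≠ 0 → w i ≠ w k := fun h h' => hik (hinj i k h h')
    have h3 : w j ≠ 0 → w j ≠ w k := fun h h' => hjk (hinj j k h h')
    have : w i + w j + w k ≤ 9 := by omega
    beta_reduce; exact_mod_cast this
  · beta_reduce; exact_mod_cast sum_le_ten_of_injOn hw hinj

theorem finite_partialPermutationVectors (m n : ℕ) : (partialPermutationVectors m n).Finite := by
  refine ((Set.finite_Iic (fun _ : Fin m => n)).image
    (fun w : Fin m → ℕ => fun i => (w i : ℝ))).subset ?_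
  rintro x ⟨w, hw, -, hx⟩
  exact ⟨w, hw, (funext hx).symm⟩

/-- Subset sums of a point of `facetPolytope m` are bounded by the sums of the largest entries
of a vertex. -/
theorem sum_le_of_mem_facetPolytope {m : ℕ} {x : Fin m → ℝ} (hx : x ∈ facetPolytope m)
    {k : ℕ} (t : Finset (Fin m)) (ht : t.card ≤ k) :
    ∑ i ∈ t, x i ≤ ∑ i ∈ Finset.range k, ((4 - i : ℕ) : ℝ) := by
  obtain ⟨h0, h1, h2, h3, h4⟩ := hx
  have mono : ∑ i ∈ Finset.range t.card, ((4 - i : ℕ) : ℝ) ≤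
      ∑ i ∈ Finset.range k, ((4 - i : ℕ) : ℝ) :=
    Finset.sum_le_sum_of_subset_of_nonneg (Finset.range_subset_range.2 ht)
      fun _ _ _ => Nat.cast_nonneg _
  refine le_trans ?_ mono
  rcases lt_or_ge t.card 4 with hc | hc
  · interval_cases hcard : t.card
    · simp [Finset.card_eq_zero.1 hcard]
    · obtain ⟨i, rfl⟩ := Finset.card_eq_one.1 hcard
      simpa using h1 i
    · obtain ⟨i, j, hij, rfl⟩ := Finset.card_eq_two.1 hcard
      rw [Finset.sum_pair hij]
      exact (h2 i j hij).trans (by norm_num [Finset.sum_range_succ])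
    · obtain ⟨i, j, k, hij, hik, hjk, rfl⟩ := Finset.card_eq_three.1 hcard
      rw [Finset.sum_insert (by simp [hij, hik]), Finset.sum_pair hjk, ← add_assoc]
      exact (h3 i j k hij hik hjk).trans (by norm_num [Finset.sum_range_succ])
  -- From four entries on, nonnegativity and the bound on the total suffice, so larger subsets need
  -- no inequality of their own.
  · calc ∑ i ∈ t, x i ≤ ∑ i, x i :=
          Finset.sum_le_univ_sum_of_nonneg h0
      _ ≤ 10 := h4
      _ = ∑ i ∈ Finset.range 4, ((4 - i : ℕ) : ℝ) := by norm_num [Finset.sum_range_succ]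
      _ ≤ _ := Finset.sum_le_sum_of_subset_of_nonneg (Finset.range_subset_range.2 hc)
          fun _ _ _ => Nat.cast_nonneg _

/-- A form of Abel summation: if all partial sums of `z` are nonpositive and `a` is antitone, then
the weighted sum is dominated by the last weight times the total sum. -/
theorem sum_mul_le_of_antitone {a z : ℕ → ℝ} (ha : Antitone a)
    (hz : ∀ k, ∑ i ∈ Finset.range k, z i ≤ 0) (k : ℕ) :
    ∑ i ∈ Finset.range k, a i * z i ≤ a k * ∑ i ∈ Finset.range k, z i := by
  induction k with
  | zero => simp
  | succ k ih =>
    rw [Finset.sum_range_succ]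
    have h1 := mul_le_mul_of_nonpos_right (ha (Nat.le_succ k)) (hz (k + 1))
    calc _ ≤ a k * ∑ i ∈ Finset.range k, z i + a k * z k := by gcongr
      _ = a k * ∑ i ∈ Finset.range (k + 1), z i := by rw [Finset.sum_range_succ, mul_add]
      _ ≤ _ := h1

/-- With weights in decreasing order and negative ones replaced by 0, every prefix sum of `x` is at
most that of 4, 3, 2, 1, 0, …; Abel summation turns these bounds into the weighted inequality. -/
theorem exists_vertex_ge {m : ℕ} {x : Fin m → ℝ} (hx : x ∈ facetPolytope m) (c : Fin m → ℝ) :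
    ∃ v ∈ partialPermutationVectors m 4, ∑ i, c i * x i ≤ ∑ i, c i * v i := by
  classical
  set σ : Equiv.Perm (Fin m) := Tuple.sort (fun i => -c i) with hσ
  have hmono : ∀ i j : Fin m, i ≤ j → c (σ j) ≤ c (σ i) := fun i j hij => by
    have := Tuple.monotone_sort (fun i => -c i) hij
    simpa using this
  -- Truncated subtraction yields 4, 3, 2, 1, 0, 0, … along the sorted order.
  let w : Fin m → ℕ := fun i => if 0 < c i then 4 - (σ.symm i : ℕ) else 0
  -- Zero padding beyond `m` keeps the positive parts antitone on all of `ℕ`.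
  let a : ℕ → ℝ := fun i => if h : i < m then max (c (σ ⟨i, h⟩)) 0 else 0
  let y : ℕ → ℝ := fun i => if h : i < m then x (σ ⟨i, h⟩) else 0
  have ha0 : ∀ i, 0 ≤ a i := fun i => by
    simp only [a]; split_ifs <;> simp
  have ha : Antitone a := by
    intro i j hij
    by_cases hj : j < m
    · have hi : i < m := hij.trans_lt hj
      simp only [a, hi, hj, dif_pos]
      exact max_le_max_right _ (hmono _ _ hij)
    · have : a j = 0 := by simp [a, hj]
      rw [this]; exact ha0 i
  have hpart : ∀ k, ∑ i ∈ Finset.range k, (y i - ((4 - i : ℕ) : ℝ)) ≤ 0 := by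
    intro k
    rw [Finset.sum_sub_distrib, sub_nonpos]
    let t : Finset (Fin m) := Finset.univ.filter (fun i => (i : ℕ) < k)
    have hy : ∑ i ∈ Finset.range k, y i = ∑ i ∈ t.map σ.toEmbedding, x i := by
      rw [Finset.sum_map]
      symm
      refine Finset.sum_bij_ne_zero (fun i _ _ => (i : ℕ)) ?_ ?_ ?_ ?_
      · intro i hi _
        simpa [t] using hi
      · intro i _ _ j _ _ h
        exact Fin.ext h
      · intro i hi hne
        have him : i < m := by
          by_contra h
          simp [y, h] at hne
        refine ⟨⟨i, him⟩, by simpa [t] using hi, ?_, rfl⟩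
        simpa [y, him] using hne
      · intro i _ _
        simp [y]
    rw [hy]
    refine sum_le_of_mem_facetPolytope hx _ ?_
    rw [Finset.card_map]
    calc t.card = (t.map Fin.valEmbedding).card := (Finset.card_map _).symm
      _ ≤ (Finset.range k).card := Finset.card_le_card fun i hi => by
          obtain ⟨j, hj, rfl⟩ := Finset.mem_map.1 hi
          simpa [t] using hj
      _ = k := Finset.card_range k
  have habel := (sum_mul_le_of_antitone ha hpart m).trans
    (mul_nonpos_of_nonneg_of_nonpos (ha0 m) (hpart m))
  simp only [mul_sub] at habel
  rw [Finset.sum_sub_distrib, sub_nonpos, ← Fin.sum_univ_eq_sum_range (fun i => a i * y i),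
    ← Fin.sum_univ_eq_sum_range (fun i => a i * ((4 - i : ℕ) : ℝ))] at habel
  refine ⟨fun i => w i, ⟨w, fun i => ?_, fun i j hi hij => ?_, fun _ => rfl⟩, ?_⟩
  · simp only [w]; split_ifs <;> omega
  · simp only [w] at hi hij
    apply σ.symm.injective
    ext
    split_ifs at hi hij <;> omega
  · rw [← Equiv.sum_comp σ, ← Equiv.sum_comp σ (fun i => c i * (w i : ℝ))]
    calc ∑ i, c (σ i) * x (σ i) ≤ ∑ i : Fin m, a i * y i := by
          refine Finset.sum_le_sum fun i _ => ?_
          simp only [a, y, Fin.is_lt, dif_pos, Fin.eta]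
          exact mul_le_mul_of_nonneg_right (le_max_left _ _) (hx.1 _)
      _ ≤ _ := habel
      _ = _ := by
          refine Finset.sum_congr rfl fun i _ => ?_
          simp only [a, w, Fin.is_lt, dif_pos, Fin.eta, Equiv.symm_apply_apply]
          split_ifs with h
          · rw [max_eq_left h.le]
          · rw [max_eq_right (not_lt.1 h)]; simp

theorem partialPermutohedron_four_eq (m : ℕ) :
    partialPermutohedron m 4 = facetPolytope m := by
  refine (convexHull_min (partialPermutationVectors_subset m)
    (convex_facetPolytope m)).antisymm fun x hx => ?_
  by_contra hnot
  obtain ⟨f, u, hf, hu⟩ := geometric_hahn_banach_closed_point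
    (convex_convexHull ℝ (partialPermutationVectors m 4))
    ((finite_partialPermutationVectors m 4).isCompact_convexHull (𝕜 := ℝ)).isClosed hnot
  have hrep : ∀ y : Fin m → ℝ, f y = ∑ i, f (Pi.single i 1) * y i := fun y => by
    conv_lhs => rw [pi_eq_sum_univ' y]
    simp [map_sum, mul_comm]
  obtain ⟨v, hv, hle⟩ := exists_vertex_ge hx fun i => f (Pi.single i 1)
  rw [← hrep, ← hrep] at hle
  linarith [hf v (subset_convexHull ℝ _ hv)]

/-! ### Slicing and the volume of the corner simplex -/

/-- The simplex of points with positive coordinates and coordinate sum at most `c`. -/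
def cornerSimplex (m : ℕ) (c : ℝ) : Set (Fin m → ℝ) :=
  {x | (∀ i, 0 < x i) ∧ ∑ i, x i ≤ c}

theorem measurableSet_cornerSimplex (m : ℕ) (c : ℝ) : MeasurableSet (cornerSimplex m c) := by
  unfold cornerSimplex
  measurability

theorem volume_eq_lintegral_cons {n : ℕ} {A : Set (Fin (n + 1) → ℝ)} (hA : MeasurableSet A) :
    volume A = ∫⁻ t : ℝ, volume {y : Fin n → ℝ | (Fin.cons t y : Fin (n + 1) → ℝ) ∈ A} := by
  have h := (volume_preserving_piFinSuccAbove (fun _ : Fin (n + 1) => ℝ) 0).symm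
  rw [← h.measure_preimage hA.nullMeasurableSet, Measure.volume_eq_prod,
    Measure.prod_apply (MeasurableEquiv.measurable _ hA)]
  refine lintegral_congr fun t => congrArg _ ?_
  ext y
  simp [MeasurableEquiv.piFinSuccAbove, Fin.insertNthEquiv]

theorem measurable_cons_right (n : ℕ) (a : ℝ) :
    Measurable fun y : Fin n → ℝ => (Fin.cons a y : Fin (n + 1) → ℝ) :=
  measurable_pi_iff.2 (Fin.cases (by simp) fun i => by simpa using measurable_pi_apply i)

theorem lintegral_Ioc_ofReal {f : ℝ → ℝ} {a b : ℝ} (hab : a ≤ b) (hf : Continuous f)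
    (h0 : ∀ t ∈ Set.Ioc a b, 0 ≤ f t) :
    ∫⁻ t in Set.Ioc a b, ENNReal.ofReal (f t) = ENNReal.ofReal (∫ t in a..b, f t) := by
  rw [intervalIntegral.integral_of_le hab, ofReal_integral_eq_lintegral_ofReal
    (hf.integrableOn_Ioc) ((ae_restrict_iff' measurableSet_Ioc).2 (ae_of_all _ h0))]

theorem cons_mem_cornerSimplex {n : ℕ} {c t : ℝ} {y : Fin n → ℝ} :
    (Fin.cons t y : Fin (n + 1) → ℝ) ∈ cornerSimplex (n + 1) c ↔
      0 < t ∧ y ∈ cornerSimplex n (c - t) := by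
  simp only [cornerSimplex, Set.mem_ofPred_eq, Fin.forall_fin_succ, Fin.cons_zero, Fin.cons_succ,
    Fin.sum_univ_succ, and_assoc, le_sub_iff_add_le, add_comm t]

theorem nonneg_of_mem_cornerSimplex {n : ℕ} {c : ℝ} {y : Fin n → ℝ} (hy : y ∈ cornerSimplex n c) :
    0 ≤ c :=
  (Finset.sum_nonneg fun i _ => (hy.1 i).le).trans hy.2

theorem integral_sub_left_pow (c a b : ℝ) (n : ℕ) :
    ∫ t in a..b, (c - t) ^ n / (n.factorial : ℝ) =
      ((c - a) ^ (n + 1) - (c - b) ^ (n + 1)) / ((n + 1).factorial : ℝ) := by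
  rw [intervalIntegral.integral_div,
    intervalIntegral.integral_comp_sub_left (fun t => t ^ n) c, integral_pow,
    Nat.factorial_succ]
  have := Nat.factorial_ne_zero n
  push_cast
  field_simp

theorem volume_cornerSimplex (n : ℕ) : ∀ {c : ℝ}, 0 ≤ c →
    volume (cornerSimplex n c) = ENNReal.ofReal (c ^ n / (n.factorial : ℝ)) := by
  induction n with
  | zero =>
    intro c hc
    have : cornerSimplex 0 c = Set.univ := by ext x; simp [cornerSimplex, hc]
    simp [this, volume_pi]
  | succ n ih =>
    intro c hc
    rw [volume_eq_lintegral_cons (measurableSet_cornerSimplex _ _)]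
    calc _ = ∫⁻ t, (Set.Ioc 0 c).indicator
          (fun t => ENNReal.ofReal ((c - t) ^ n / (n.factorial : ℝ))) t := by
          refine lintegral_congr fun t => ?_
          by_cases ht : t ∈ Set.Ioc 0 c
          · rw [Set.indicator_of_mem ht, ← ih (sub_nonneg.2 ht.2)]
            congr 1
            ext y
            simp [cons_mem_cornerSimplex, ht.1]
          · rw [Set.indicator_of_notMem ht]
            refine measure_mono_null (t := ∅) (fun y hy => ht ?_) measure_empty
            obtain ⟨h0, h1⟩ := cons_mem_cornerSimplex.1 hy
            exact ⟨h0, sub_nonneg.1 (nonneg_of_mem_cornerSimplex h1)⟩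
      _ = ENNReal.ofReal (∫ t in 0..c, (c - t) ^ n / (n.factorial : ℝ)) := by
          rw [lintegral_indicator measurableSet_Ioc]
          refine lintegral_Ioc_ofReal hc (by fun_prop) fun t ht => ?_
          have := sub_nonneg.2 ht.2
          positivity
      _ = _ := by rw [integral_sub_left_pow]; simp

/-! ### Volumes of a single pair cut and a single triple cut -/

/-- The part of the simplex cut off by the inequality `x i + x j ≤ 7`. -/
def pairCut {m : ℕ} (i j : Fin m) : Set (Fin m → ℝ) :=
  {x | x ∈ cornerSimplex m 10 ∧ x i ≤ 4 ∧ x j ≤ 4 ∧ 7 < x i + x j}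

/-- The part of the simplex cut off by the inequality `x i + x j + x k ≤ 9`. -/
def tripleCut {m : ℕ} (i j k : Fin m) : Set (Fin m → ℝ) :=
  {x | x ∈ cornerSimplex m 10 ∧ (x i ≤ 4 ∧ x j ≤ 4 ∧ x k ≤ 4) ∧
    (x i + x j ≤ 7 ∧ x i + x k ≤ 7 ∧ x j + x k ≤ 7) ∧ 9 < x i + x j + x k}

theorem measurableSet_pairCut {m : ℕ} (i j : Fin m) : MeasurableSet (pairCut i j) := by
  have := measurableSet_cornerSimplex m 10
  unfold pairCut
  measurability

theorem measurableSet_tripleCut {m : ℕ} (i j k : Fin m) : MeasurableSet (tripleCut i j k) := by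
  have := measurableSet_cornerSimplex m 10
  unfold tripleCut
  measurability

/-- The two large coordinates `a`, `b` have sum at most 8, so the others range freely over a simplex
of size `10 - a - b`, whose volume is integrated over a triangle. -/
theorem volume_pairCut_zero_one (n : ℕ) :
    volume (pairCut (0 : Fin (n + 2)) 1) = ENNReal.ofReal
      (3 ^ (n + 1) / ((n + 1).factorial : ℝ) -
        (3 ^ (n + 2) - 2 ^ (n + 2)) / ((n + 2).factorial : ℝ)) := by
  have hmem : ∀ a b (y : Fin n → ℝ),
      (Fin.cons a (Fin.cons b y : Fin (n + 1) → ℝ) : Fin (n + 2) → ℝ) ∈ pairCut 0 1 ↔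
      (a ∈ Set.Ioc 3 4 ∧ b ∈ Set.Ioc (7 - a) 4) ∧ y ∈ cornerSimplex n (10 - a - b) := by
    intro a b y
    have h1 : (Fin.cons a (Fin.cons b y : Fin (n + 1) → ℝ) : Fin (n + 2) → ℝ) 1 = b := rfl
    simp only [pairCut, Set.mem_ofPred_eq, cons_mem_cornerSimplex, h1, Fin.cons_zero, Set.mem_Ioc]
    constructor
    · rintro ⟨⟨h1, h2, h3⟩, h4, h5, h6⟩
      exact ⟨⟨⟨by linarith, by linarith⟩, by linarith, by linarith⟩, h3⟩
    · rintro ⟨⟨⟨h1, h2⟩, h4, h5⟩, h3⟩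
      exact ⟨⟨by linarith, by linarith, h3⟩, by linarith, by linarith, by linarith⟩
  have hmeas : ∀ a, MeasurableSet
      {y : Fin (n + 1) → ℝ | (Fin.cons a y : Fin (n + 2) → ℝ) ∈ pairCut 0 1} := fun a =>
    (measurableSet_pairCut _ _).preimage (measurable_cons_right _ a)
  rw [volume_eq_lintegral_cons (measurableSet_pairCut _ _)]
  simp_rw [fun a => volume_eq_lintegral_cons (hmeas a), Set.mem_ofPred_eq, hmem]
  have inner : ∀ a ∈ Set.Ioc (3 : ℝ) 4, ∫⁻ b, volume {y : Fin n → ℝ |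
      (a ∈ Set.Ioc 3 4 ∧ b ∈ Set.Ioc (7 - a) 4) ∧ y ∈ cornerSimplex n (10 - a - b)} =
      ENNReal.ofReal ((3 ^ (n + 1) - (6 - a) ^ (n + 1)) / ((n + 1).factorial : ℝ)) := by
    intro a ha
    calc _ = ∫⁻ b, (Set.Ioc (7 - a) 4).indicator
          (fun b => ENNReal.ofReal ((10 - a - b) ^ n / (n.factorial : ℝ))) b := by
          refine lintegral_congr fun b => ?_
          by_cases hb : b ∈ Set.Ioc (7 - a) 4
          · rw [Set.indicator_of_mem hb, ← volume_cornerSimplex n (by linarith [hb.2, ha.2])]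
            congr 1
            ext y
            simp only [ha, hb, Set.mem_ofPred_eq, true_and, and_self]
          · simp [hb]
      _ = ENNReal.ofReal (∫ b in (7 - a)..4, (10 - a - b) ^ n / (n.factorial : ℝ)) := by
          rw [lintegral_indicator measurableSet_Ioc]
          refine lintegral_Ioc_ofReal (by linarith [ha.1]) (by fun_prop) fun b hb => ?_
          have : 0 ≤ 10 - a - b := by linarith [ha.2, hb.2]
          positivity
      -- At the endpoints `7 - a` and `4`, the remaining size is `3` and `6 - a`.
      _ = _ := by rw [integral_sub_left_pow]; congr 4 <;> ring
  calc _ = ∫⁻ a, (Set.Ioc (3 : ℝ) 4).indicator (fun a => ENNReal.ofReal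
        ((3 ^ (n + 1) - (6 - a) ^ (n + 1)) / ((n + 1).factorial : ℝ))) a := by
        refine lintegral_congr fun a => ?_
        by_cases ha : a ∈ Set.Ioc (3 : ℝ) 4
        · rw [Set.indicator_of_mem ha, inner a ha]
        · simp [ha]
    _ = ENNReal.ofReal (∫ a in (3 : ℝ)..4,
          (3 ^ (n + 1) - (6 - a) ^ (n + 1)) / ((n + 1).factorial : ℝ)) := by
        rw [lintegral_indicator measurableSet_Ioc]
        refine lintegral_Ioc_ofReal (by norm_num) (by fun_prop) fun a ha => ?_
        have : (6 - a) ^ (n + 1) ≤ 3 ^ (n + 1) :=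
          pow_le_pow_left₀ (by linarith [ha.2]) (by linarith [ha.1]) _
        exact div_nonneg (by linarith) (by positivity)
    _ = _ := by
        simp_rw [sub_div]
        rw [intervalIntegral.integral_sub (by simp)
          (Continuous.intervalIntegrable (by fun_prop) _ _), integral_sub_left_pow]
        norm_num [sub_div]

/-- The hexagonal slices of the cut-off corner at coordinate sum `10 - t`, projected to the first
two coordinates, as `t` varies. -/
def hexagonSlab : Set (ℝ × ℝ × ℝ) :=
  {p | p.1 ∈ Set.Ico 0 1 ∧ p.2.1 ∈ Set.Icc (3 - p.1) 4 ∧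
    p.2.2 ∈ Set.Icc (max (3 - p.1) (6 - p.1 - p.2.1)) (min 4 (7 - p.2.1))}

theorem measurableSet_hexagonSlab : MeasurableSet hexagonSlab := by
  unfold hexagonSlab
  simp only [Set.mem_Ico, Set.mem_Icc]
  measurability

theorem integral_hexagon {t : ℝ} (ht : 0 ≤ t) :
    ∫ a in (3 - t)..4, (1 + t - |a - 3|) = (1 + 4 * t + t ^ 2) / 2 := by
  have hi : ∀ a b : ℝ, IntervalIntegrable (fun a : ℝ => 1 + t - |a - 3|) volume a b := fun a b =>
    Continuous.intervalIntegrable (by fun_prop) _ _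
  rw [← intervalIntegral.integral_add_adjacent_intervals (hi (3 - t) 3) (hi 3 4)]
  have h1 : ∫ a in (3 - t)..3, (1 + t - |a - 3|) = ∫ a in (3 - t)..3, ((t - 2) + a * 1) := by
    refine intervalIntegral.integral_congr fun a ha => ?_
    rw [Set.uIcc_of_le (by linarith)] at ha
    rw [abs_of_nonpos (by linarith [ha.2])]
    ring
  have h2 : ∫ a in (3 : ℝ)..4, (1 + t - |a - 3|) = ∫ a in (3 : ℝ)..4, ((4 + t) + a * (-1)) := by
    refine intervalIntegral.integral_congr fun a ha => ?_
    rw [Set.uIcc_of_le (by norm_num)] at ha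
    rw [abs_of_nonneg (by linarith [ha.1])]
    ring
  have hlin : ∀ p q c d : ℝ, ∫ a in p..q, (c + a * d) = (q - p) * c + (q ^ 2 - p ^ 2) / 2 * d :=
    fun p q c d => by
      rw [intervalIntegral.integral_add (by simp)
        (Continuous.intervalIntegrable (by fun_prop) _ _), intervalIntegral.integral_mul_const,
        intervalIntegral.integral_const, integral_id, smul_eq_mul]
  rw [h1, h2, hlin, hlin]
  ring

theorem volume_hexagon_fiber (t a : ℝ) :
    volume (Set.Icc (max (3 - t) (6 - t - a)) (min 4 (7 - a))) =
      ENNReal.ofReal (1 + t - |a - 3|) := by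
  rw [Real.volume_Icc]
  congr 1
  -- The maximum and the minimum both switch branch at `a = 3`.
  rcases le_total a 3 with h | h
  · rw [max_eq_right (by linarith), min_eq_left (by linarith), abs_of_nonpos (by linarith)]
    ring
  · rw [max_eq_left (by linarith), min_eq_right (by linarith), abs_of_nonneg (by linarith)]
    ring

theorem lintegral_hexagon (n : ℕ) {t : ℝ} (ht : t ∈ Set.Ico (0 : ℝ) 1) :
    ∫⁻ a, ∫⁻ b, hexagonSlab.indicator (fun p => ENNReal.ofReal (p.1 ^ n / (n.factorial : ℝ)))
      (t, a, b) =
    ENNReal.ofReal ((1 + 4 * t + t ^ 2) / 2 * (t ^ n / (n.factorial : ℝ))) := by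
  have ht0 := ht.1
  calc _ = ∫⁻ a, (Set.Icc (3 - t) 4).indicator (fun a => ENNReal.ofReal (1 + t - |a - 3|) *
        ENNReal.ofReal (t ^ n / (n.factorial : ℝ))) a := by
        refine lintegral_congr fun a => ?_
        by_cases ha : a ∈ Set.Icc (3 - t) 4
        · rw [Set.indicator_of_mem ha, ← volume_hexagon_fiber, mul_comm,
            ← lintegral_indicator_const measurableSet_Icc]
          refine lintegral_congr fun b => ?_
          simp only [Set.indicator, hexagonSlab, Set.mem_ofPred_eq, ha, ht, true_and]
        · simp only [Set.indicator, hexagonSlab, Set.mem_ofPred_eq, ha, false_and, and_false, if_false,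
            lintegral_zero]
    _ = ENNReal.ofReal (∫ a in (3 - t)..4, (1 + t - |a - 3|)) *
          ENNReal.ofReal (t ^ n / (n.factorial : ℝ)) := by
        rw [lintegral_indicator measurableSet_Icc, lintegral_mul_const _ (by fun_prop),
          ← Measure.restrict_congr_set Ioc_ae_eq_Icc, lintegral_Ioc_ofReal (by linarith) (by fun_prop)]
        intro a ha
        have : |a - 3| ≤ 1 + t := abs_le.2 ⟨by linarith [ha.1], by linarith [ha.2]⟩
        linarith
    _ = _ := by
        rw [integral_hexagon ht0, ← ENNReal.ofReal_mul (by positivity)]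

theorem integral_hexagon_mul_pow (n : ℕ) :
    ∫ t in (0 : ℝ)..1, (1 + 4 * t + t ^ 2) / 2 * (t ^ n / (n.factorial : ℝ)) =
      (1 / (n + 1 : ℝ) + 4 / (n + 2) + 1 / (n + 3)) / 2 / (n.factorial : ℝ) := by
  have h : ∀ t : ℝ, (1 + 4 * t + t ^ 2) / 2 * (t ^ n / (n.factorial : ℝ)) =
      (t ^ n + 4 * t ^ (n + 1) + t ^ (n + 2)) / 2 / (n.factorial : ℝ) := fun t => by ring
  simp_rw [h]
  rw [intervalIntegral.integral_div, intervalIntegral.integral_div, intervalIntegral.integral_add,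
    intervalIntegral.integral_add, intervalIntegral.integral_const_mul]
  · simp only [integral_pow]
    push_cast
    norm_num [add_assoc]
    ring
  all_goals exact Continuous.intervalIntegrable (by fun_prop) _ _

/-- Replacing the third coordinate by the slack `t = 10 - a - b - d` makes the simplex volume depend
on `t` alone. With `t` outermost, the integrand is the area of a hexagon times `t ^ n / n !`. -/
theorem volume_tripleCut_zero_one_two (n : ℕ) :
    volume (tripleCut (0 : Fin (n + 3)) 1 2) = ENNReal.ofReal
      ((1 / (n + 1 : ℝ) + 4 / (n + 2) + 1 / (n + 3)) / 2 / (n.factorial : ℝ)) := by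
  set K : ℝ × ℝ × ℝ → ENNReal :=
    hexagonSlab.indicator (fun p => ENNReal.ofReal (p.1 ^ n / (n.factorial : ℝ))) with hKdef
  have hK : Measurable K := by
    refine Measurable.indicator ?_ measurableSet_hexagonSlab
    fun_prop
  have hmem : ∀ a b d (y : Fin n → ℝ),
      (Fin.cons a (Fin.cons b (Fin.cons d y : Fin (n + 1) → ℝ) : Fin (n + 2) → ℝ) :
        Fin (n + 3) → ℝ) ∈ tripleCut 0 1 2 ↔
      (10 - a - b - d, a, b) ∈ hexagonSlab ∧ y ∈ cornerSimplex n (10 - a - b - d) := by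
    intro a b d y
    have h1 : (Fin.cons a (Fin.cons b (Fin.cons d y : Fin (n + 1) → ℝ) : Fin (n + 2) → ℝ) :
      Fin (n + 3) → ℝ) 1 = b := rfl
    have h2 : (Fin.cons a (Fin.cons b (Fin.cons d y : Fin (n + 1) → ℝ) : Fin (n + 2) → ℝ) :
      Fin (n + 3) → ℝ) 2 = d := rfl
    simp only [tripleCut, Set.mem_ofPred_eq, cons_mem_cornerSimplex, h1, h2, Fin.cons_zero,
      Set.mem_Icc, Set.mem_Ico, hexagonSlab, max_le_iff, le_min_iff]
    constructor
    · rintro ⟨⟨_, _, _, hy⟩, ⟨h4, h5, h6⟩, ⟨h7, h8, h9⟩, h10⟩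
      have := nonneg_of_mem_cornerSimplex hy
      refine ⟨⟨⟨?_, ?_⟩, ⟨?_, ?_⟩, ⟨?_, ?_⟩, ?_, ?_⟩, hy⟩ <;> linarith
    · rintro ⟨⟨⟨h1, h2⟩, ⟨h3, h4⟩, ⟨h5, h6⟩, h7, h8⟩, hy⟩
      refine ⟨⟨?_, ?_, ?_, hy⟩, ⟨?_, ?_, ?_⟩, ⟨?_, ?_, ?_⟩, ?_⟩ <;> linarith
  have hm1 : ∀ a, MeasurableSet
      {y : Fin (n + 2) → ℝ | (Fin.cons a y : Fin (n + 3) → ℝ) ∈ tripleCut 0 1 2} := fun a =>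
    (measurableSet_tripleCut _ _ _).preimage (measurable_cons_right _ a)
  have hm2 : ∀ a b, MeasurableSet {y : Fin (n + 1) → ℝ |
      (Fin.cons a (Fin.cons b y : Fin (n + 2) → ℝ) : Fin (n + 3) → ℝ) ∈ tripleCut 0 1 2} :=
    fun a b => (hm1 a).preimage (measurable_cons_right _ b)
  rw [volume_eq_lintegral_cons (measurableSet_tripleCut _ _ _)]
  simp_rw [fun a => volume_eq_lintegral_cons (hm1 a), Set.mem_ofPred_eq,
    fun a b => volume_eq_lintegral_cons (hm2 a b), Set.mem_ofPred_eq, hmem]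
  calc _ = ∫⁻ a, ∫⁻ b, ∫⁻ d, K (10 - a - b - d, a, b) := by
        refine lintegral_congr fun a => lintegral_congr fun b => lintegral_congr fun d => ?_
        by_cases h : (10 - a - b - d, a, b) ∈ hexagonSlab
        · rw [hKdef, Set.indicator_of_mem h, ← volume_cornerSimplex n h.1.1]
          congr 1
          ext y
          simp only [h, true_and, Set.mem_ofPred_eq]
        · rw [hKdef, Set.indicator_of_notMem h]
          simp [h]
    _ = ∫⁻ a, ∫⁻ b, ∫⁻ t, K (t, a, b) := by
        refine lintegral_congr fun a => lintegral_congr fun b => ?_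
        -- Lebesgue measure is invariant under the reflection `d ↦ 10 - a - b - d`.
        exact lintegral_sub_left_eq_self (fun t => K (t, a, b)) (10 - a - b)
    _ = ∫⁻ a, ∫⁻ t, ∫⁻ b, K (t, a, b) := by
        refine lintegral_congr fun a => lintegral_lintegral_swap ?_
        exact (hK.comp (by fun_prop : Measurable fun p : ℝ × ℝ => (p.2, a, p.1))).aemeasurable
    _ = ∫⁻ t, ∫⁻ a, ∫⁻ b, K (t, a, b) := by
        refine lintegral_lintegral_swap (Measurable.aemeasurable ?_)
        exact Measurable.lintegral_prod_right
          (hK.comp (by fun_prop : Measurable fun p : (ℝ × ℝ) × ℝ => (p.1.2, p.1.1, p.2)))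
    _ = ∫⁻ t, (Set.Ico (0 : ℝ) 1).indicator (fun t => ENNReal.ofReal
          ((1 + 4 * t + t ^ 2) / 2 * (t ^ n / (n.factorial : ℝ)))) t := by
        refine lintegral_congr fun t => ?_
        by_cases ht : t ∈ Set.Ico (0 : ℝ) 1
        · rw [Set.indicator_of_mem ht, lintegral_hexagon n ht]
        · simp only [hKdef, Set.indicator, hexagonSlab, Set.mem_ofPred_eq, ht, false_and, if_false,
            lintegral_zero]
    _ = _ := by
        rw [lintegral_indicator measurableSet_Ico, Measure.restrict_congr_set Ico_ae_eq_Ioc,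
          lintegral_Ioc_ofReal zero_le_one (by fun_prop), integral_hexagon_mul_pow]
        intro t ht
        have := ht.1.le
        positivity

/-! ### Transfer to arbitrary indices by permuting coordinates -/

theorem measurePreserving_comp_perm {m : ℕ} (g : Equiv.Perm (Fin m)) :
    MeasurePreserving (fun x : Fin m → ℝ => x ∘ g) volume volume := by
  convert volume_measurePreserving_piCongrLeft (fun _ : Fin m => ℝ) g.symm using 1
  ext x i
  have := Equiv.piCongrLeft_apply_apply (fun _ : Fin m => ℝ) g.symm x (g i)
  simp only [Equiv.symm_apply_apply] at this
  exact this.symm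

theorem comp_perm_mem_cornerSimplex {m : ℕ} (g : Equiv.Perm (Fin m)) {x : Fin m → ℝ} {c : ℝ} :
    x ∘ g ∈ cornerSimplex m c ↔ x ∈ cornerSimplex m c := by
  simp only [cornerSimplex, Set.mem_ofPred_eq, Function.comp_apply, Equiv.sum_comp g x]
  rw [g.forall_congr_left (p := fun i => 0 < x (g i))]
  simp

theorem volume_pairCut {n : ℕ} {i j : Fin (n + 2)} (hij : i ≠ j) :
    volume (pairCut i j) = ENNReal.ofReal
      (3 ^ (n + 1) / ((n + 1).factorial : ℝ) -
        (3 ^ (n + 2) - 2 ^ (n + 2)) / ((n + 2).factorial : ℝ)) := by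
  -- Double transitivity of the symmetric group moves `(0, 1)` to `(i, j)`.
  obtain ⟨g, hg⟩ := (Equiv.Perm.isMultiplyPretransitive (Fin (n + 2)) 2).exists_smul_eq
    ⟨![0, 1], by simp [Function.Injective, Fin.forall_fin_two]⟩
    ⟨![i, j], by simp [Function.Injective, Fin.forall_fin_two, hij, hij.symm]⟩
  have h0 : g 0 = i := DFunLike.congr_fun hg 0
  have h1 : g 1 = j := DFunLike.congr_fun hg 1
  rw [← volume_pairCut_zero_one, ← (measurePreserving_comp_perm g).measure_preimage
    (measurableSet_pairCut 0 1).nullMeasurableSet]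
  congr 1
  ext x
  simp only [pairCut, Set.mem_preimage, Set.mem_ofPred_eq, comp_perm_mem_cornerSimplex,
    Function.comp_apply, h0, h1]

theorem volume_tripleCut {n : ℕ} {i j k : Fin (n + 3)} (hij : i ≠ j) (hik : i ≠ k)
    (hjk : j ≠ k) :
    volume (tripleCut i j k) = ENNReal.ofReal
      ((1 / (n + 1 : ℝ) + 4 / (n + 2) + 1 / (n + 3)) / 2 / (n.factorial : ℝ)) := by
  obtain ⟨g, hg⟩ := (Equiv.Perm.isMultiplyPretransitive (Fin (n + 3)) 3).exists_smul_eq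
    ⟨![0, 1, 2], by
      have h : 2 % (n + 3) = 2 := Nat.mod_eq_of_lt (by omega)
      have h1 : (1 : Fin (n + 3)) ≠ 2 := by simp [Fin.ext_iff, h]
      have h2 : (0 : Fin (n + 3)) ≠ 2 := by simp [Fin.ext_iff, h]
      simp [Function.Injective, Fin.forall_fin_succ, h1, h1.symm, h2, h2.symm]⟩
    ⟨![i, j, k], by
      simp [Function.Injective, Fin.forall_fin_succ, hij, hij.symm, hik, hik.symm, hjk, hjk.symm]⟩
  have h0 : g 0 = i := DFunLike.congr_fun hg 0
  have h1 : g 1 = j := DFunLike.congr_fun hg 1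
  have h2 : g 2 = k := DFunLike.congr_fun hg 2
  rw [← volume_tripleCut_zero_one_two, ← (measurePreserving_comp_perm g).measure_preimage
    (measurableSet_tripleCut 0 1 2).nullMeasurableSet]
  congr 1
  ext x
  simp only [tripleCut, Set.mem_preimage, Set.mem_ofPred_eq, comp_perm_mem_cornerSimplex,
    Function.comp_apply, h0, h1, h2]

/-! ### Points with a coordinate exceeding 4 -/

/-- The points of the simplex whose coordinates in `p` all exceed `4`. -/
def largeOn {m : ℕ} (p : Finset (Fin m)) : Set (Fin m → ℝ) :=
  {x | x ∈ cornerSimplex m 10 ∧ ∀ i ∈ p, 4 < x i}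

theorem measurableSet_largeOn {m : ℕ} (p : Finset (Fin m)) : MeasurableSet (largeOn p) := by
  refine (measurableSet_cornerSimplex _ _).inter ?_
  have : {x : Fin m → ℝ | ∀ i ∈ p, 4 < x i} = ⋂ i ∈ p, {x | 4 < x i} := by ext; simp
  change MeasurableSet {x : Fin m → ℝ | ∀ i ∈ p, 4 < x i}
  rw [this]
  exact p.measurableSet_biInter fun i _ =>
    measurableSet_lt measurable_const (measurable_pi_apply i)

/-- Subtracting 4 from each coordinate in `p` is a translation onto a smaller corner simplex; at
most two such coordinates keep its size nonnegative. -/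
theorem volume_real_largeOn {m : ℕ} {p : Finset (Fin m)} (hp : p.card ≤ 2) :
    volume.real (largeOn p) = (10 - 4 * p.card : ℝ) ^ m / (m.factorial : ℝ) := by
  have hp' : (p.card : ℝ) ≤ 2 := by exact_mod_cast hp
  have h0 : (0 : ℝ) ≤ 10 - 4 * p.card := by linarith
  have : (fun h => (fun i => if i ∈ p then (4 : ℝ) else 0) + h) ⁻¹' largeOn p =
      cornerSimplex m (10 - 4 * p.card) := by
    ext x
    have hsum : ∑ i, ((if i ∈ p then (4 : ℝ) else 0) + x i) = 4 * p.card + ∑ i, x i := by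
      rw [Finset.sum_add_distrib, Finset.sum_ite_mem, Finset.univ_inter, Finset.sum_const,
        nsmul_eq_mul, mul_comm]
    simp only [largeOn, cornerSimplex, Set.mem_preimage, Set.mem_ofPred_eq, Pi.add_apply, hsum,
      le_sub_iff_add_le']
    constructor
    · rintro ⟨⟨h1, h2⟩, h3⟩
      refine ⟨fun i => ?_, h2⟩
      by_cases hi : i ∈ p
      · simpa [hi] using h3 i hi
      · simpa [hi] using h1 i
    · rintro ⟨h1, h2⟩
      refine ⟨⟨fun i => ?_, h2⟩, fun i hi => by simpa [hi] using h1 i⟩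
      have := h1 i
      split_ifs <;> linarith
  rw [measureReal_def, ← measure_preimage_add volume _ (largeOn p), this,
    volume_cornerSimplex m h0, ENNReal.toReal_ofReal (by positivity)]

theorem volume_cornerSimplex_ne_top (m : ℕ) : volume (cornerSimplex m 10) ≠ ⊤ := by
  rw [volume_cornerSimplex m (by norm_num)]
  exact ENNReal.ofReal_ne_top

theorem sum_le_of_mem_cornerSimplex {m : ℕ} {c : ℝ} {x : Fin m → ℝ} (hx : x ∈ cornerSimplex m c)
    (p : Finset (Fin m)) : ∑ i ∈ p, x i ≤ c :=
  (Finset.sum_le_univ_sum_of_nonneg fun i => (hx.1 i).le).trans hx.2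

/-- Inclusion-exclusion for the points of the simplex with a coordinate exceeding `4`; at most two
coordinates can do so. -/
theorem indicator_iUnion_largeOn {m : ℕ} (x : Fin m → ℝ) :
    (⋃ i, largeOn {i}).indicator (1 : (Fin m → ℝ) → ℝ) x =
      ∑ p ∈ Finset.powersetCard 1 Finset.univ, (largeOn p).indicator 1 x -
      ∑ p ∈ Finset.powersetCard 2 Finset.univ, (largeOn p).indicator 1 x := by
  classical
  by_cases hx : x ∈ cornerSimplex m 10
  · set S : Finset (Fin m) := Finset.univ.filter fun i => 4 < x i with hS
    have hmem : ∀ p, x ∈ largeOn p ↔ p ⊆ S := fun p => by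
      simp [largeOn, hx, hS, Finset.subset_iff]
    have hsum : ∀ k, ∑ p ∈ Finset.powersetCard k Finset.univ,
        (largeOn p).indicator (1 : (Fin m → ℝ) → ℝ) x = S.card.choose k := fun k => by
      rw [← Finset.card_powersetCard, Finset.card_eq_sum_ones, Nat.cast_sum]
      simp only [Set.indicator, hmem, Pi.one_apply]
      rw [← Finset.sum_filter]
      refine Finset.sum_congr ?_ fun _ _ => by simp
      ext p
      simp [Finset.mem_powersetCard, and_comm]
    have hcard : S.card ≤ 2 := by
      have h1 : S.card • (4 : ℝ) ≤ ∑ i ∈ S, x i :=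
        Finset.card_nsmul_le_sum _ _ _ fun i hi => (Finset.mem_filter.1 hi).2.le
      have h2 := h1.trans (sum_le_of_mem_cornerSimplex hx S)
      rw [nsmul_eq_mul] at h2
      have h3 : (S.card : ℝ) < 3 := by linarith
      exact Nat.lt_succ_iff.1 (by exact_mod_cast h3)
    have hU : x ∈ (⋃ i, largeOn {i}) ↔ S.card ≠ 0 := by
      rw [Finset.card_ne_zero]
      simp [hmem, Finset.Nonempty]
    rw [hsum, hsum, Set.indicator]
    simp only [hU]
    -- For `s = 0, 1, 2`, the difference `s - s.choose 2` is `0, 1, 1`.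
    interval_cases S.card <;> norm_num
  · have h0 : ∀ p : Finset (Fin m), x ∉ largeOn p := fun p h => hx h.1
    simp [Set.indicator, h0]

theorem volume_real_iUnion_largeOn (m : ℕ) :
    volume.real (⋃ i : Fin m, largeOn {i}) =
      (m * 6 ^ m - m.choose 2 * 2 ^ m) / (m.factorial : ℝ) := by
  have hint : ∀ p : Finset (Fin m),
      Integrable ((largeOn p).indicator (1 : (Fin m → ℝ) → ℝ)) := fun p => by
    refine (integrable_indicator_iff (measurableSet_largeOn p)).2 (integrableOn_const ?_)
    exact measure_ne_top_of_subset (fun x hx => hx.1) (volume_cornerSimplex_ne_top m)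
  have hsum : ∀ k ≤ 2, ∫ x, ∑ p ∈ Finset.powersetCard k (Finset.univ : Finset (Fin m)),
      (largeOn p).indicator (1 : (Fin m → ℝ) → ℝ) x =
        m.choose k * ((10 - 4 * k : ℝ) ^ m / (m.factorial : ℝ)) := fun k hk => by
    rw [integral_finsetSum _ fun p _ => hint p]
    rw [Finset.sum_congr rfl fun p hp => ?_]
    · rw [Finset.sum_const, Finset.card_powersetCard, Finset.card_univ, Fintype.card_fin,
        nsmul_eq_mul]
    · obtain rfl := (Finset.mem_powersetCard.1 hp).2
      rw [integral_indicator_one (measurableSet_largeOn p), volume_real_largeOn hk]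
  rw [← integral_indicator_one (.iUnion fun i => measurableSet_largeOn _)]
  simp_rw [indicator_iUnion_largeOn]
  rw [integral_sub (integrable_finsetSum _ fun p _ => hint p)
    (integrable_finsetSum _ fun p _ => hint p), hsum 1 (by norm_num), hsum 2 le_rfl]
  norm_num
  ring

/-! ### Disjointness and total volume of the cuts -/

theorem sum_add_le_of_mem_cornerSimplex {m : ℕ} {c : ℝ} {x : Fin m → ℝ}
    (hx : x ∈ cornerSimplex m c) {p : Finset (Fin m)} {i : Fin m} (hi : i ∉ p) :
    ∑ l ∈ p, x l + x i ≤ c := by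
  classical
  simpa [Finset.sum_insert hi, add_comm] using sum_le_of_mem_cornerSimplex hx (insert i p)

/-- `pairCut`, indexed by a finite set of coordinates. -/
def pairCutOn {m : ℕ} (p : Finset (Fin m)) : Set (Fin m → ℝ) :=
  {x | x ∈ cornerSimplex m 10 ∧ (∀ i ∈ p, x i ≤ 4) ∧ 7 < ∑ i ∈ p, x i}

/-- `tripleCut`, indexed by a finite set of coordinates. -/
def tripleCutOn {m : ℕ} (p : Finset (Fin m)) : Set (Fin m → ℝ) :=
  {x | x ∈ cornerSimplex m 10 ∧ (∀ i ∈ p, x i ≤ 4) ∧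
    (∀ i ∈ p, ∀ j ∈ p, i ≠ j → x i + x j ≤ 7) ∧ 9 < ∑ i ∈ p, x i}

theorem pairCutOn_pair {m : ℕ} {i j : Fin m} (hij : i ≠ j) : pairCutOn {i, j} = pairCut i j := by
  ext x
  simp [pairCutOn, pairCut, Finset.sum_pair hij, and_assoc]

theorem tripleCutOn_triple {m : ℕ} {i j k : Fin m} (hij : i ≠ j) (hik : i ≠ k) (hjk : j ≠ k) :
    tripleCutOn {i, j, k} = tripleCut i j k := by
  ext x
  simp only [tripleCutOn, tripleCut, Set.mem_ofPred_eq, Finset.mem_insert, Finset.mem_singleton,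
    forall_eq_or_imp, forall_eq, Finset.sum_insert (show i ∉ ({j, k} : Finset (Fin m)) by
      simp [hij, hik]), Finset.sum_pair hjk, hij, hik, hjk, hij.symm, hik.symm, hjk.symm, ne_eq,
    not_true_eq_false, not_false_eq_true, false_imp_iff, true_imp_iff, true_and, and_true,
    ← add_assoc]
  refine and_congr_right fun _ => and_congr_right fun _ => and_congr_left fun _ => ?_
  rw [add_comm (x j) (x i), add_comm (x k) (x i), add_comm (x k) (x j)]
  tauto

theorem lt_three_of_mem_pairCutOn {m : ℕ} {p : Finset (Fin m)} {x : Fin m → ℝ}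
    (hx : x ∈ pairCutOn p) {i : Fin m} (hi : i ∉ p) : x i < 3 := by
  linarith [sum_add_le_of_mem_cornerSimplex hx.1 hi, hx.2.2]

theorem lt_one_of_mem_tripleCutOn {m : ℕ} {p : Finset (Fin m)} {x : Fin m → ℝ}
    (hx : x ∈ tripleCutOn p) {i : Fin m} (hi : i ∉ p) : x i < 1 := by
  linarith [sum_add_le_of_mem_cornerSimplex hx.1 hi, hx.2.2.2]

theorem three_lt_of_mem_pairCutOn {m : ℕ} {p : Finset (Fin m)} (hp : p.card = 2) {x : Fin m → ℝ}
    (hx : x ∈ pairCutOn p) {i : Fin m} (hi : i ∈ p) : 3 < x i := by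
  obtain ⟨a, b, hab, rfl⟩ := Finset.card_eq_two.1 hp
  rw [pairCutOn_pair hab] at hx
  obtain ⟨-, h1, h2, h3⟩ := hx
  rcases Finset.mem_insert.1 hi with rfl | hi
  · linarith
  · obtain rfl := Finset.mem_singleton.1 hi
    linarith

theorem two_lt_of_mem_tripleCutOn {m : ℕ} {p : Finset (Fin m)} (hp : p.card = 3) {x : Fin m → ℝ}
    (hx : x ∈ tripleCutOn p) {i : Fin m} (hi : i ∈ p) : 2 < x i := by
  obtain ⟨a, b, c, hab, hac, hbc, rfl⟩ := Finset.card_eq_three.1 hp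
  rw [tripleCutOn_triple hab hac hbc] at hx
  obtain ⟨-, -, ⟨h1, h2, h3⟩, h4⟩ := hx
  simp only [Finset.mem_insert, Finset.mem_singleton] at hi
  rcases hi with rfl | rfl | rfl <;> linarith

theorem exists_mem_notMem_of_card_eq {α : Type*} {p q : Finset α} (h : p.card = q.card)
    (hpq : p ≠ q) : ∃ i ∈ q, i ∉ p :=
  Finset.not_subset.1 fun hsub => hpq (Finset.eq_of_subset_of_card_le hsub h.le).symm

/-- A coordinate in `q` but not in `p` would be both above 3 and below 3. -/
theorem pairwiseDisjoint_pairCutOn (m : ℕ) :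
    (Finset.powersetCard 2 (Finset.univ : Finset (Fin m)) : Set (Finset (Fin m))).PairwiseDisjoint
      pairCutOn := by
  intro p hp q hq hpq
  have hp' := (Finset.mem_powersetCard.1 hp).2
  have hq' := (Finset.mem_powersetCard.1 hq).2
  refine Set.disjoint_left.2 fun x hxp hxq => ?_
  obtain ⟨i, hiq, hip⟩ := exists_mem_notMem_of_card_eq (hp'.trans hq'.symm) hpq
  linarith [lt_three_of_mem_pairCutOn hxp hip, three_lt_of_mem_pairCutOn hq' hxq hiq]

theorem pairwiseDisjoint_tripleCutOn (m : ℕ) :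
    (Finset.powersetCard 3 (Finset.univ : Finset (Fin m)) : Set (Finset (Fin m))).PairwiseDisjoint
      tripleCutOn := by
  intro p hp q hq hpq
  have hp' := (Finset.mem_powersetCard.1 hp).2
  have hq' := (Finset.mem_powersetCard.1 hq).2
  refine Set.disjoint_left.2 fun x hxp hxq => ?_
  obtain ⟨i, hiq, hip⟩ := exists_mem_notMem_of_card_eq (hp'.trans hq'.symm) hpq
  linarith [lt_one_of_mem_tripleCutOn hxp hip, two_lt_of_mem_tripleCutOn hq' hxq hiq]

/-- All points of the simplex cut off by pair inequalities. -/
def pairCuts (m : ℕ) : Set (Fin m → ℝ) :=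
  ⋃ p ∈ Finset.powersetCard 2 (Finset.univ : Finset (Fin m)), pairCutOn p

/-- All points of the simplex cut off by triple inequalities. -/
def tripleCuts (m : ℕ) : Set (Fin m → ℝ) :=
  ⋃ p ∈ Finset.powersetCard 3 (Finset.univ : Finset (Fin m)), tripleCutOn p

theorem measurableSet_pairCutOn {m : ℕ} {p : Finset (Fin m)} (hp : p.card = 2) :
    MeasurableSet (pairCutOn p) := by
  obtain ⟨a, b, hab, rfl⟩ := Finset.card_eq_two.1 hp
  rw [pairCutOn_pair hab]
  exact measurableSet_pairCut a b

theorem measurableSet_tripleCutOn {m : ℕ} {p : Finset (Fin m)} (hp : p.card = 3) :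
    MeasurableSet (tripleCutOn p) := by
  obtain ⟨a, b, c, hab, hac, hbc, rfl⟩ := Finset.card_eq_three.1 hp
  rw [tripleCutOn_triple hab hac hbc]
  exact measurableSet_tripleCut a b c

theorem measurableSet_pairCuts (m : ℕ) : MeasurableSet (pairCuts m) :=
  Finset.measurableSet_biUnion _ fun _ hp =>
    measurableSet_pairCutOn (Finset.mem_powersetCard.1 hp).2

theorem measurableSet_tripleCuts (m : ℕ) : MeasurableSet (tripleCuts m) :=
  Finset.measurableSet_biUnion _ fun _ hp =>
    measurableSet_tripleCutOn (Finset.mem_powersetCard.1 hp).2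

theorem factorial_mul_volume_real_pairCutOn {m : ℕ} {p : Finset (Fin m)} (hp : p.card = 2) :
    (m.factorial : ℝ) * volume.real (pairCutOn p) = 3 ^ m * (m - 3) / 3 + 2 ^ m := by
  obtain ⟨a, b, hab, rfl⟩ := Finset.card_eq_two.1 hp
  obtain ⟨n, rfl⟩ : ∃ n, m = n + 2 :=
    Nat.exists_eq_add_of_le' (hp ▸ Finset.card_le_univ _ |>.trans_eq (Fintype.card_fin m))
  -- Needed because `ENNReal.ofReal` truncates negative values.
  have hnn : (0 : ℝ) ≤ 3 ^ (n + 1) / ((n + 1).factorial : ℝ) -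
      (3 ^ (n + 2) - 2 ^ (n + 2)) / ((n + 2).factorial : ℝ) := by
    have hf : ((n + 2).factorial : ℝ) = (n + 2) * (n + 1).factorial := by
      rw [Nat.factorial_succ]; push_cast; ring
    have hf0 : (0 : ℝ) < (n + 1).factorial := by positivity
    have key : (0 : ℝ) ≤ 3 ^ (n + 1) * (n + 2) - (3 ^ (n + 2) - 2 ^ (n + 2)) := by
      -- The quantity equals `3 ^ (n + 1) * (n - 1) + 2 ^ (n + 2)`; only `n = 0` makes its first
      -- term negative.
      rcases n with _ | n
      · norm_num
      · have h : (0 : ℝ) ≤ 3 ^ (n + 2) * n + 2 ^ (n + 3) := by positivity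
        push_cast
        linear_combination h
    rw [hf, sub_nonneg, div_le_div_iff₀ (by positivity) hf0]
    linear_combination ((n + 1).factorial : ℝ) * key
  rw [pairCutOn_pair hab, measureReal_def, volume_pairCut hab, ENNReal.toReal_ofReal hnn,
    Nat.factorial_succ (n + 1)]
  have := Nat.factorial_ne_zero (n + 1)
  push_cast
  field_simp
  ring

theorem factorial_mul_volume_real_tripleCutOn {m : ℕ} {p : Finset (Fin m)} (hp : p.card = 3) :
    (m.factorial : ℝ) * volume.real (tripleCutOn p) = 3 * (m : ℝ) ^ 2 - 6 * m + 1 := by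
  obtain ⟨a, b, c, hab, hac, hbc, rfl⟩ := Finset.card_eq_three.1 hp
  obtain ⟨n, rfl⟩ : ∃ n, m = n + 3 :=
    Nat.exists_eq_add_of_le' (hp ▸ Finset.card_le_univ _ |>.trans_eq (Fintype.card_fin m))
  rw [tripleCutOn_triple hab hac hbc, measureReal_def, volume_tripleCut hab hac hbc,
    ENNReal.toReal_ofReal (by positivity), Nat.factorial_succ, Nat.factorial_succ,
    Nat.factorial_succ]
  have := Nat.factorial_ne_zero n
  push_cast
  field_simp
  ring

/-! ### Decomposition of the simplex and the final count -/

/-- Each point is sorted by the first kind of inequality it violates: single, then pair, then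
triple. The extra upper bounds inside the cuts record that the earlier kinds hold. -/
theorem cornerSimplex_ten_eq (m : ℕ) :
    cornerSimplex m 10 = (facetPolytope m ∩ {x | ∀ i, 0 < x i}) ∪
      ((⋃ i, largeOn {i}) ∪ (pairCuts m ∪ tripleCuts m)) := by
  classical
  ext x
  simp only [Set.mem_union, Set.mem_inter_iff, Set.mem_iUnion, pairCuts, tripleCuts, exists_prop]
  constructor
  · intro hx
    by_cases h1 : ∃ i, 4 < x i
    · obtain ⟨i, hi⟩ := h1
      exact .inr (.inl ⟨i, hx, by simpa using hi⟩)
    push Not at h1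
    by_cases h2 : ∃ i j, i ≠ j ∧ 7 < x i + x j
    · obtain ⟨i, j, hij, h⟩ := h2
      refine .inr (.inr (.inl ⟨{i, j}, by simp [Finset.card_pair hij], ?_⟩))
      rw [pairCutOn_pair hij]
      exact ⟨hx, h1 i, h1 j, h⟩
    push Not at h2
    by_cases h3 : ∃ i j k, i ≠ j ∧ i ≠ k ∧ j ≠ k ∧ 9 < x i + x j + x k
    · obtain ⟨i, j, k, hij, hik, hjk, h⟩ := h3
      refine .inr (.inr (.inr ⟨{i, j, k}, ?_, ?_⟩))
      · simp [Finset.card_eq_three.2 ⟨i, j, k, hij, hik, hjk, rfl⟩]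
      rw [tripleCutOn_triple hij hik hjk]
      exact ⟨hx, ⟨h1 i, h1 j, h1 k⟩, ⟨h2 i j hij, h2 i k hik, h2 j k hjk⟩, h⟩
    push Not at h3
    exact .inl ⟨⟨fun i => (hx.1 i).le, h1, h2, h3, hx.2⟩, hx.1⟩
  · rintro (⟨h, h0⟩ | ⟨i, h⟩ | ⟨p, -, h⟩ | ⟨p, -, h⟩)
    exacts [⟨h0, h.2.2.2.2⟩, h.1, h.1, h.1]

theorem disjoint_facetPolytope_cuts (m : ℕ) :
    Disjoint (facetPolytope m ∩ {x | ∀ i, 0 < x i})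
      ((⋃ i, largeOn {i}) ∪ (pairCuts m ∪ tripleCuts m)) := by
  rw [Set.disjoint_left]
  rintro x ⟨⟨-, h1, h2, h3, -⟩, -⟩ h
  simp only [Set.mem_union, Set.mem_iUnion, pairCuts, tripleCuts, exists_prop] at h
  rcases h with ⟨i, h⟩ | ⟨p, hp, h⟩ | ⟨p, hp, h⟩
  · exact (h.2 i (Finset.mem_singleton_self i)).not_ge (h1 i)
  · obtain ⟨a, b, hab, rfl⟩ := Finset.card_eq_two.1 (Finset.mem_powersetCard.1 hp).2
    rw [pairCutOn_pair hab] at h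
    exact h.2.2.2.not_ge (h2 a b hab)
  · obtain ⟨a, b, c, hab, hac, hbc, rfl⟩ :=
      Finset.card_eq_three.1 (Finset.mem_powersetCard.1 hp).2
    rw [tripleCutOn_triple hab hac hbc] at h
    exact h.2.2.2.not_ge (h3 a b c hab hac hbc)

theorem disjoint_iUnion_largeOn_cuts (m : ℕ) :
    Disjoint (⋃ i : Fin m, largeOn {i}) (pairCuts m ∪ tripleCuts m) := by
  rw [Set.disjoint_left]
  intro x hx h
  simp only [Set.mem_union, Set.mem_iUnion, pairCuts, tripleCuts, exists_prop] at hx h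
  obtain ⟨i, -, hi⟩ := hx
  have hi := hi i (Finset.mem_singleton_self i)
  rcases h with ⟨p, -, h⟩ | ⟨p, -, h⟩
  · by_cases hip : i ∈ p
    · linarith [h.2.1 i hip]
    · linarith [lt_three_of_mem_pairCutOn h hip]
  · by_cases hip : i ∈ p
    · linarith [h.2.1 i hip]
    · linarith [lt_one_of_mem_tripleCutOn h hip]

/-- If the pair lies in the triple, its sum is at most 7 there. Otherwise one of its coordinates
exceeds 3, while coordinates outside the triple are below 1. -/
theorem disjoint_pairCuts_tripleCuts (m : ℕ) : Disjoint (pairCuts m) (tripleCuts m) := by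
  rw [Set.disjoint_left]
  intro x hx h
  simp only [Set.mem_iUnion, pairCuts, tripleCuts, exists_prop] at hx h
  obtain ⟨p, hp, hxp⟩ := hx
  obtain ⟨q, hq, hxq⟩ := h
  have hp' := (Finset.mem_powersetCard.1 hp).2
  by_cases hpq : p ⊆ q
  · obtain ⟨a, b, hab, rfl⟩ := Finset.card_eq_two.1 hp'
    rw [pairCutOn_pair hab] at hxp
    exact hxp.2.2.2.not_ge (hxq.2.2.1 a (hpq (by simp)) b (hpq (by simp)) hab)
  · obtain ⟨i, hip, hiq⟩ := Finset.not_subset.1 hpq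
    linarith [lt_one_of_mem_tripleCutOn hxq hiq, three_lt_of_mem_pairCutOn hp' hxp hip]

/-- The corner simplex demands strict positivity, which costs only the null coordinate hyperplanes.
-/
theorem volume_facetPolytope_inter_pos (m : ℕ) :
    volume (facetPolytope m ∩ {x | ∀ i, 0 < x i}) = volume (facetPolytope m) := by
  refine measure_congr (Filter.EventuallyEq.symm ?_)
  have h : ∀ᵐ x : Fin m → ℝ, ∀ i, x i ≠ 0 := by
    refine ae_all_iff.2 fun i => ?_
    rw [ae_iff]
    simpa [volume_pi] using Measure.pi_hyperplane (fun _ : Fin m => (volume : Measure ℝ)) i 0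
  filter_upwards [h] with x hx
  refine propext ⟨fun hf => ⟨hf, fun i => lt_of_le_of_ne (hf.1 i) (hx i).symm⟩, fun hf => hf.1⟩

theorem volume_real_facetPolytope_add (m : ℕ) :
    volume.real (facetPolytope m) + (volume.real (⋃ i : Fin m, largeOn {i}) +
      (volume.real (pairCuts m) + volume.real (tripleCuts m))) =
      volume.real (cornerSimplex m 10) := by
  have hfin : ∀ {s : Set (Fin m → ℝ)}, s ⊆ cornerSimplex m 10 → volume s ≠ ⊤ := fun hs =>
    measure_ne_top_of_subset hs (volume_cornerSimplex_ne_top m)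
  have hsub := (cornerSimplex_ten_eq m).ge
  have h1 := Set.union_subset_iff.1 hsub
  have h2 := Set.union_subset_iff.1 h1.2
  have h3 := Set.union_subset_iff.1 h2.2
  have hU := (measurableSet_pairCuts m).union (measurableSet_tripleCuts m)
  rw [measureReal_def volume (facetPolytope m), ← volume_facetPolytope_inter_pos, ← measureReal_def,
    cornerSimplex_ten_eq,
    measureReal_union (disjoint_facetPolytope_cuts m)
      ((MeasurableSet.iUnion fun i => measurableSet_largeOn _).union hU) (hfin h1.1) (hfin h1.2),
    measureReal_union (disjoint_iUnion_largeOn_cuts m) hU (hfin h2.1) (hfin h2.2),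
    measureReal_union (disjoint_pairCuts_tripleCuts m) (measurableSet_tripleCuts m)
      (hfin h3.1) (hfin h3.2)]

theorem factorial_mul_volume_real_pairCuts (m : ℕ) :
    (m.factorial : ℝ) * volume.real (pairCuts m) =
      m.choose 2 * (3 ^ m * (m - 3) / 3 + 2 ^ m) := by
  rw [pairCuts, measureReal_biUnion_finset (pairwiseDisjoint_pairCutOn m)
    (fun p hp => measurableSet_pairCutOn (Finset.mem_powersetCard.1 hp).2)
    (fun p _ => measure_ne_top_of_subset (fun x hx => hx.1) (volume_cornerSimplex_ne_top m)),
    Finset.mul_sum, Finset.sum_congr rfl fun p hp =>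
      factorial_mul_volume_real_pairCutOn (Finset.mem_powersetCard.1 hp).2]
  rw [Finset.sum_const, Finset.card_powersetCard, Finset.card_univ, Fintype.card_fin, nsmul_eq_mul]

theorem factorial_mul_volume_real_tripleCuts (m : ℕ) :
    (m.factorial : ℝ) * volume.real (tripleCuts m) =
      m.choose 3 * (3 * (m : ℝ) ^ 2 - 6 * m + 1) := by
  rw [tripleCuts, measureReal_biUnion_finset (pairwiseDisjoint_tripleCutOn m)
    (fun p hp => measurableSet_tripleCutOn (Finset.mem_powersetCard.1 hp).2)
    (fun p _ => measure_ne_top_of_subset (fun x hx => hx.1) (volume_cornerSimplex_ne_top m)),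
    Finset.mul_sum, Finset.sum_congr rfl fun p hp =>
      factorial_mul_volume_real_tripleCutOn (Finset.mem_powersetCard.1 hp).2]
  rw [Finset.sum_const, Finset.card_powersetCard, Finset.card_univ, Fintype.card_fin, nsmul_eq_mul]

theorem mainTheorem9 (m : ℕ) (hm : 1 ≤ m) :
    normalizedVolume (partialPermutohedron m 4) =
      (10 : ℝ) ^ m - (m : ℝ) * 6 ^ m
        - ((m : ℝ) * ((m : ℝ) - 1) * ((m : ℝ) - 3) / 6) * 3 ^ m
        - (3 * (m : ℝ) ^ 2 - 6 * (m : ℝ) + 1) * (m.choose 3 : ℝ) := by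
  have hfac : (m.factorial : ℝ) ≠ 0 := Nat.cast_ne_zero.2 (Nat.factorial_ne_zero m)
  have hT : (m.factorial : ℝ) * volume.real (cornerSimplex m 10) = 10 ^ m := by
    rw [measureReal_def, volume_cornerSimplex m (by norm_num),
      ENNReal.toReal_ofReal (by positivity), mul_div_cancel₀ _ hfac]
  have hA : (m.factorial : ℝ) * volume.real (⋃ i : Fin m, largeOn {i}) =
      m * 6 ^ m - m.choose 2 * 2 ^ m := by
    rw [volume_real_iUnion_largeOn, mul_div_cancel₀ _ hfac]
  have hB := factorial_mul_volume_real_pairCuts m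
  have hC := factorial_mul_volume_real_tripleCuts m
  rw [← volume_real_facetPolytope_add m, mul_add, mul_add, mul_add, hA, hB, hC,
    Nat.cast_choose_two] at hT
  rw [normalizedVolume, partialPermutohedron_four_eq]
  -- The `m.choose 2 * 2 ^ m` from doubly large points cancels the one from the pair cuts.
  linear_combination hT
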